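/- **Setting.** Consider $m$ bosonic modes with Hamiltonian $H=\sum_{j}\omega_j a_j^\dagger a_j$, $\omega_j>0$, and let $\mathbf Z=\frac12\begin{pmatrix}\mathbb I&0\\0&-\mathbb I\end{pmatrix}$. A Gaussian state is given by its first and second moments $\vec r=\begin{pmatrix}\vec\alpha^*\\ \vec\alpha\end{pmatrix}$, $M=\begin{pmatrix}\mu^*&\chi\\ \chi^*&\mu\end{pmatrix}$ ($\mu$ Hermitian, $\chi$ symmetric), subject to the uncertainty relation $M+\mathbf Z\ge0$. A Gaussian channel is given by a triple $(X,Y,\vec d)$ acting by $\vec r\mapsto X\vec r+\vec d$, $M\mapsto XMX^\dagger+Y$, where $X,Y$ have the block form $\begin{pmatrix}P^*&Q\\Q^*&P\end{pmatrix}$, $\vec d=\begin{pmatrix}\vec\delta^*\\ \vec\delta\end{pmatrix}$, and $Y\ge X\mathbf Z_{\rm in}X^\dagger-\mathbf Z_{\rm out}$; it is a Gaussian unitary if $Y=0$ and $X\mathbf ZX^\dagger=\mathbf Z$. Time translation by $t$ is the channel with $X=\mathrm{diag}(e^{-i\omega_jt})\oplus\mathrm{diag}(e^{i\omega_jt})$,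 $Y=0$, $\vec d=0$. A Gaussian covariant operation (GCO) is a Gaussian channel that commutes with all time translations, and a state is symmetric if it is invariant under all time translations. For a GCO write $A$ and $B$ for the lower right blocks of $X$ and $Y$, so that $\vec\alpha\mapsto A\vec\alpha$ and $\mu\mapsto A\mu A^\dagger+B$. A GCO $\mathcal E$ on a system $S$ is *freely dilatable* if there are an ancilla $R$ of finitely many modes with positive frequencies, a symmetric Gaussian state $\rho_R$ of $R$, and a covariant Gaussian unitary $\mathbf U$ on $SR$ with $\mathcal E(\rho)=\mathrm{tr}_R[\mathbf U(\rho\otimes\rho_R)\mathbf U^\dagger]$ for all Gaussian states $\rho$ of $S$. **Theorem 1.** (i) If a GCO from a system to itself has no fixed point among the Gaussian states, i.e. among the moments $(\vec r,M)$ satisfying $M+\mathbf Z\ge0$, then it is not freely dilatable. (ii) More precisely, if a GCO from a system to itself is freely dilatable, then with $\Delta=B-\frac12(\mathbb I-AA^\dagger)$ the series $\mu_\star=\frac{\mathbb I}2+\sum_{n\ge0}A^n\Delta (A^\dagger)^n$ converges, and the moments $\vec\alpha=0$, $\mu=\mu_\star$, $\chi=0$ are those of a Gaussian state that is a fixed point.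 (iii) The converse of (i) is false: there is a GCO from a system to itself that has a Gaussian fixed point but is not freely dilatable. Explicitly, for two modes of equal frequency $\omega>0$ and reals $\eta_1\ge0$, $\eta_2>1$ with $\eta_1\eta_2<1$, $b_{11}\ge\frac12(1-\eta_1)$, $b_{22}\ge\frac12(\eta_2-1)$, there is a GCO with $$A=\begin{pmatrix}0&\sqrt{\eta_1}\\ \sqrt{\eta_2}&0\end{pmatrix},\qquad B=\begin{pmatrix}b_{11}&0\\0&b_{22}\end{pmatrix},$$ and it fixes the Gaussian state with $\vec\alpha=0$, $\chi=0$, $\mu=\mathrm{diag}\left(\frac{b_{11}+\eta_1b_{22}}{1-\eta_1\eta_2},\frac{b_{22}+\eta_2b_{11}}{1-\eta_1\eta_2}\right)$, while $\mathbb I-AA^\dagger\ge0$ fails and the operation is not freely dilatable. -/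

import Mathlib

open scoped Matrix ComplexOrder

noncomputable section

namespace GaussianCV

variable {ι κ : Type}

/-- `Quad ι` indexes the `2m` ladder-operator coordinates of a system whose bosonic modes are
indexed by `ι`: `inl j` is the annihilation operator of mode `j` and `inr j` is its creation
operator. -/
abbrev Quad (ι : Type) : Type := ι ⊕ ι

/-- `r = (α*, α)`: the lower half of the vector is the complex conjugate of the upper half. -/
def IsConjVec (r : Quad ι → ℂ) : Prop :=
  ∀ i, star (r i) = r i.swap

/-- `M = [[P*, Q], [Q*, P]]`: exchanging annihilation and creation operators conjugates the
entries. -/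
def IsConjMat (M : Matrix (Quad ι) (Quad κ) ℂ) : Prop :=
  ∀ i j, star (M i j) = M i.swap j.swap

/-- The matrix `Z = (1/2) [[I, 0], [0, -I]]` of the canonical commutation relations. -/
def Z (ι : Type) [DecidableEq ι] : Matrix (Quad ι) (Quad ι) ℂ :=
  Matrix.diagonal (Sum.elim (fun _ => (1 / 2 : ℂ)) (fun _ => -(1 / 2 : ℂ)))

/-- A Gaussian quantum state on the modes `ι`, given by its first moments `r = (α*, α)` and its
second moments `M = [[μ*, χ], [χ*, μ]]`, subject to the uncertainty relation `M + Z ≥ 0`.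
(The uncertainty relation contains that `M` is Hermitian, i.e. that `μ` is Hermitian and that `χ`
is symmetric.) -/
@[ext]
structure GaussianState (ι : Type) [Fintype ι] [DecidableEq ι] where
  r : Quad ι → ℂ
  M : Matrix (Quad ι) (Quad ι) ℂ
  r_conj : IsConjVec r
  M_conj : IsConjMat M
  uncertainty : (M + Z ι).PosSemidef

/-- A Gaussian channel from the modes `ι` to the modes `κ`: a triple `(X, Y, d)` acting on moments
as `r ↦ X r + d`, `M ↦ X M X† + Y`, subject to `Y ≥ X Z_in X† - Z_out`. -/
structure GaussianChannel (ι κ : Type) [Fintype ι] [DecidableEq ι] [Fintype κ] [DecidableEq κ] where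
  X : Matrix (Quad κ) (Quad ι) ℂ
  Y : Matrix (Quad κ) (Quad κ) ℂ
  d : Quad κ → ℂ
  X_conj : IsConjMat X
  Y_conj : IsConjMat Y
  d_conj : IsConjVec d
  cp : (Y - (X * Z ι * Xᴴ - Z κ)).PosSemidef

theorem IsConjMat.mul {ι' : Type} [Fintype κ] {M : Matrix (Quad ι) (Quad κ) ℂ}
    {N : Matrix (Quad κ) (Quad ι') ℂ} (hM : IsConjMat M)
    (hN : IsConjMat N) : IsConjMat (M * N) := by
  intro i j
  simp only [Matrix.mul_apply, star_sum, star_mul']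
  rw [← Equiv.sum_comp (Equiv.sumComm κ κ) (fun k => M i.swap k * N k j.swap)]
  exact Finset.sum_congr rfl fun k _ => by rw [hM, hN]; rfl

theorem IsConjMat.conjTranspose {M : Matrix (Quad ι) (Quad κ) ℂ}
    (hM : IsConjMat M) : IsConjMat Mᴴ := by
  intro i j
  simp only [Matrix.conjTranspose_apply]
  rw [hM j i]

theorem IsConjMat.add {M N : Matrix (Quad ι) (Quad κ) ℂ}
    (hM : IsConjMat M) (hN : IsConjMat N) : IsConjMat (M + N) := by
  intro i j
  simp only [Matrix.add_apply, star_add]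
  rw [hM, hN]

theorem IsConjMat.mulVec [Fintype κ] {M : Matrix (Quad ι) (Quad κ) ℂ} {r : Quad κ → ℂ}
    (hM : IsConjMat M) (hr : IsConjVec r) : IsConjVec (M *ᵥ r) := by
  intro i
  simp only [Matrix.mulVec, dotProduct, star_sum, star_mul']
  rw [← Equiv.sum_comp (Equiv.sumComm κ κ) (fun k => M i.swap k * r k)]
  exact Finset.sum_congr rfl fun k _ => by rw [hM, hr]; rfl

variable [Fintype ι] [DecidableEq ι] [Fintype κ] [DecidableEq κ]

namespace GaussianState

/-- The block `μ` of the second moments. -/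
def mu (ρ : GaussianState ι) : Matrix ι ι ℂ := ρ.M.toBlocks₂₂

/-- The block `χ` of the second moments. -/
def chi (ρ : GaussianState ι) : Matrix ι ι ℂ := ρ.M.toBlocks₁₂

/-- The product state `ρ ⊗ σ` of two Gaussian states: the moments are direct sums, with the
coordinates reordered as (all annihilation operators, all creation operators). -/
def tensor (ρ : GaussianState ι) (σ : GaussianState κ) : GaussianState (ι ⊕ κ) where
  r := Sum.elim ρ.r σ.r ∘ Equiv.sumSumSumComm ι κ ι κ
  M := (Matrix.fromBlocks ρ.M 0 0 σ.M).submatrix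
    (Equiv.sumSumSumComm ι κ ι κ) (Equiv.sumSumSumComm ι κ ι κ)
  r_conj := by
    rintro ((i | i) | (i | i))
    · exact ρ.r_conj (Sum.inl i)
    · exact σ.r_conj (Sum.inl i)
    · exact ρ.r_conj (Sum.inr i)
    · exact σ.r_conj (Sum.inr i)
  M_conj := by
    rintro ((i | i) | (i | i)) ((j | j) | (j | j)) <;>
      first
        | simp; done
        | exact ρ.M_conj (Sum.inl i) (Sum.inl j)
        | exact ρ.M_conj (Sum.inl i) (Sum.inr j)
        | exact ρ.M_conj (Sum.inr i) (Sum.inl j)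
        | exact ρ.M_conj (Sum.inr i) (Sum.inr j)
        | exact σ.M_conj (Sum.inl i) (Sum.inl j)
        | exact σ.M_conj (Sum.inl i) (Sum.inr j)
        | exact σ.M_conj (Sum.inr i) (Sum.inl j)
        | exact σ.M_conj (Sum.inr i) (Sum.inr j)
  uncertainty := by
    have h : (Matrix.fromBlocks ρ.M 0 0 σ.M).submatrix
          (Equiv.sumSumSumComm ι κ ι κ) (Equiv.sumSumSumComm ι κ ι κ) + Z (ι ⊕ κ)
        = (Matrix.fromBlocks (ρ.M + Z ι) 0 0 (σ.M + Z κ)).submatrix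
          (Equiv.sumSumSumComm ι κ ι κ) (Equiv.sumSumSumComm ι κ ι κ) := by
      ext ((i | i) | (i | i)) ((j | j) | (j | j)) <;> simp [Z, Matrix.diagonal_apply]
    rw [h]
    refine Matrix.PosSemidef.submatrix ?_ _
    refine Matrix.PosSemidef.of_dotProduct_mulVec_nonneg ?_ fun x => ?_
    · exact Matrix.IsHermitian.fromBlocks ρ.uncertainty.1 (by simp) σ.uncertainty.1
    · have h1 := ρ.uncertainty.dotProduct_mulVec_nonneg (x ∘ Sum.inl)
      have h2 := σ.uncertainty.dotProduct_mulVec_nonneg (x ∘ Sum.inr)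
      have h3 : star x = Sum.elim (star (x ∘ Sum.inl)) (star (x ∘ Sum.inr)) := by
        ext (i | i) <;> rfl
      rw [Matrix.fromBlocks_mulVec, h3, sumElim_dotProduct_sumElim]
      simpa using add_nonneg h1 h2

/-- The partial trace over the modes `κ` of a state on `ι ⊕ κ`: only the moments of the modes `ι`
are kept. -/
def partialTrace (ρ : GaussianState (ι ⊕ κ)) : GaussianState ι where
  r := ρ.r ∘ Sum.map Sum.inl Sum.inl
  M := ρ.M.submatrix (Sum.map Sum.inl Sum.inl) (Sum.map Sum.inl Sum.inl)
  r_conj := by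
    rintro (i | i)
    · exact ρ.r_conj (Sum.inl (Sum.inl i))
    · exact ρ.r_conj (Sum.inr (Sum.inl i))
  M_conj := by
    rintro (i | i) (j | j)
    · exact ρ.M_conj (Sum.inl (Sum.inl i)) (Sum.inl (Sum.inl j))
    · exact ρ.M_conj (Sum.inl (Sum.inl i)) (Sum.inr (Sum.inl j))
    · exact ρ.M_conj (Sum.inr (Sum.inl i)) (Sum.inl (Sum.inl j))
    · exact ρ.M_conj (Sum.inr (Sum.inl i)) (Sum.inr (Sum.inl j))
  uncertainty := by
    have h : ρ.M.submatrix (Sum.map Sum.inl Sum.inl) (Sum.map Sum.inl Sum.inl) + Z ι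
        = (ρ.M + Z (ι ⊕ κ)).submatrix (Sum.map Sum.inl Sum.inl) (Sum.map Sum.inl Sum.inl) := by
      ext (i | i) (j | j) <;> simp [Z, Matrix.diagonal_apply]
    rw [h]
    exact ρ.uncertainty.submatrix _

end GaussianState

namespace GaussianChannel

/-- The action of a Gaussian channel on Gaussian states. -/
def apply (E : GaussianChannel ι κ) (ρ : GaussianState ι) : GaussianState κ where
  r := E.X *ᵥ ρ.r + E.d
  M := E.X * ρ.M * E.Xᴴ + E.Y
  r_conj := by
    intro i
    have h := E.X_conj.mulVec ρ.r_conj i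
    simp only [Pi.add_apply, star_add, h, E.d_conj i]
  M_conj := ((E.X_conj.mul ρ.M_conj).mul E.X_conj.conjTranspose).add E.Y_conj
  uncertainty := by
    have h : E.X * ρ.M * E.Xᴴ + E.Y + Z κ
        = E.X * (ρ.M + Z ι) * E.Xᴴ + (E.Y - (E.X * Z ι * E.Xᴴ - Z κ)) := by
      rw [Matrix.mul_add, Matrix.add_mul]; abel
    rw [h]
    exact (ρ.uncertainty.mul_mul_conjTranspose_same _).add E.cp

/-- The time translation `ρ ↦ e^{-iHt} ρ e^{iHt}` generated by the free Hamiltonian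
`H = ∑ j, ω j • a_j† a_j`: annihilation operators acquire the phase `e^{-i ω_j t}` and creation
operators the conjugate phase. -/
def timeTranslation (ω : ι → ℝ) (t : ℝ) : GaussianChannel ι ι where
  X := Matrix.diagonal (Sum.elim (fun j => Complex.exp (-(Complex.I * (ω j * t : ℝ))))
    (fun j => Complex.exp (Complex.I * (ω j * t : ℝ))))
  Y := 0
  d := 0
  X_conj := by
    rintro (i | i) (j | j) <;> by_cases h : i = j <;>
      simp [h, ← Complex.exp_conj]
  Y_conj := by intro i j; simp
  d_conj := by intro i; simp
  cp := by
    have h : (0 : Matrix (Quad ι) (Quad ι) ℂ) - (Matrix.diagonal (Sum.elim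
          (fun j => Complex.exp (-(Complex.I * (ω j * t : ℝ))))
          (fun j => Complex.exp (Complex.I * (ω j * t : ℝ)))) * Z ι *
        (Matrix.diagonal (Sum.elim (fun j => Complex.exp (-(Complex.I * (ω j * t : ℝ))))
          (fun j => Complex.exp (Complex.I * (ω j * t : ℝ)))))ᴴ - Z ι) = 0 := by
      rw [Z, Matrix.diagonal_conjTranspose, Matrix.diagonal_mul_diagonal,
        Matrix.diagonal_mul_diagonal, zero_sub, neg_eq_zero, sub_eq_zero]
      congr 1
      ext (i | i) <;> simp [← Complex.exp_conj, mul_right_comm, ← Complex.exp_add]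
    rw [h]
    exact Matrix.PosSemidef.zero

/-- `E` is a Gaussian covariant operation from the system with mode frequencies `ω` to the system
with mode frequencies `ν`: it commutes with time translation. -/
def IsCovariant (E : GaussianChannel ι κ) (ω : ι → ℝ) (ν : κ → ℝ) : Prop :=
  ∀ (t : ℝ) (ρ : GaussianState ι),
    E.apply ((timeTranslation ω t).apply ρ) = (timeTranslation ν t).apply (E.apply ρ)

/-- `E` is (conjugation by) a Gaussian unitary: a triple `(S, 0, d)` with `S Z S† = Z`. -/
def IsUnitary (E : GaussianChannel ι ι) : Prop :=
  E.Y = 0 ∧ E.X * Z ι * E.Xᴴ = Z ι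

/-- The matrix `A` of a Gaussian covariant operation: `α ↦ A α`. -/
def A (E : GaussianChannel ι κ) : Matrix κ ι ℂ := E.X.toBlocks₂₂

/-- The matrix `B` of a Gaussian covariant operation: `μ ↦ A μ A† + B`. -/
def B (E : GaussianChannel ι κ) : Matrix κ κ ℂ := E.Y.toBlocks₂₂

end GaussianChannel

/-- A state is symmetric if it is invariant under time translation. -/
def GaussianState.IsSymmetric (ρ : GaussianState ι) (ω : ι → ℝ) : Prop :=
  ∀ t : ℝ, (GaussianChannel.timeTranslation ω t).apply ρ = ρ

/-- The operation `E` on the system with mode frequencies `ω` has a free dilation: there are an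
ancilla `R` of finitely many modes with positive frequencies, a symmetric Gaussian state `ρR` of
`R`, and a covariant Gaussian unitary `U` on the joint system, such that
`E(ρ) = tr_R [U (ρ ⊗ ρR) U†]`. -/
def GaussianChannel.FreelyDilatable (E : GaussianChannel ι ι) (ω : ι → ℝ) : Prop :=
  ∃ (n : ℕ) (ν : Fin n → ℝ) (ρR : GaussianState (Fin n))
    (U : GaussianChannel (ι ⊕ Fin n) (ι ⊕ Fin n)),
    (∀ k, 0 < ν k) ∧ ρR.IsSymmetric ν ∧
    U.IsUnitary ∧ U.IsCovariant (Sum.elim ω ν) (Sum.elim ω ν) ∧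
    ∀ ρ : GaussianState ι, E.apply ρ = (U.apply (ρ.tensor ρR)).partialTrace

end GaussianCV

end

/-!
Covariance with positive frequencies forbids any mixing of annihilation and creation operators,
because their phases `exp (-iωt)` and `exp (iνt)` rotate in opposite directions
(`IsCovariant.X_eq`, `IsCovariant.Y_eq`), and it forbids
displacements (`IsCovariant.d_eq_zero`). A covariant channel is therefore determined by `A` and
`B`, and a covariant Gaussian unitary by an ordinary unitary matrix `V`, since for
block-diagonal `X` the symplectic condition `X Z X† = Z` says `V V† = 1`.

In a free dilation, `A` is the system-system block of `V`. Let `W` be its system-ancilla block.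
Then `A A† + W W† = 1` and `B = W μ_R W†` (`FreelyDilatable.exists_block`), so that
`Δ = B - (1 - A A†) / 2 = W (μ_R - 1/2) W†`. The sum of `Aⁿ W W† (A†)ⁿ` over `n < N` telescopes to
`1 - A^N (A†)^N ≤ 1`, so every entry of `Aⁿ W` is square summable in `n`, whence
`∑ Aⁿ Δ (A†)ⁿ` converges (`summable_pow_mul_mul_pow`). Its sum `S` satisfies `S = A S A† + Δ`,
which is the fixed-point equation for `μ⋆ = 1/2 + S`. Complete positivity gives `Δ ≥ 0`, hence
`S ≥ 0`, which is the uncertainty relation for `μ⋆`.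

For the counterexample it suffices that free dilatability forces `1 - A A† = W W† ≥ 0`, whereas
`A A† = diag (η₁, η₂)` there with `η₂ > 1`.
-/

open scoped Matrix ComplexOrder

noncomputable section

namespace GaussianCV

variable {ι κ : Type}

/-! ### Matrices and conjugation-invariant vectors -/

/-- Vectors of the form `(α*, α)` span `ℂ^{2m}` over `ℂ`, so they separate matrices. -/
theorem eq_of_mulVec_eq_of_isConjVec [Fintype ι] [DecidableEq ι]
    {K L : Matrix (Quad κ) (Quad ι) ℂ}
    (h : ∀ r, IsConjVec r → K *ᵥ r = L *ᵥ r) : K = L := by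
  have key : ∀ i j, K i (Sum.inl j) = L i (Sum.inl j) ∧ K i (Sum.inr j) = L i (Sum.inr j) := by
    intro i j
    have h₁ := congrFun (h (Pi.single (Sum.inl j) 1 + Pi.single (Sum.inr j) 1) (by
      rintro (k | k) <;> by_cases hk : k = j <;> simp [hk])) i
    have h₂ := congrFun (h (Pi.single (Sum.inl j) Complex.I +
        Pi.single (Sum.inr j) (-Complex.I)) (by
      rintro (k | k) <;> by_cases hk : k = j <;> simp [hk])) i
    simp only [Matrix.mulVec_add, Pi.add_apply, Matrix.mulVec_single, Matrix.col_apply,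
      Pi.smul_apply, MulOpposite.smul_eq_mul_unop, MulOpposite.unop_op, mul_one] at h₁ h₂
    have h₃ : K i (Sum.inl j) - K i (Sum.inr j) = L i (Sum.inl j) - L i (Sum.inr j) := by
      apply mul_right_cancel₀ Complex.I_ne_zero
      linear_combination h₂
    constructor
    · linear_combination (h₁ + h₃) / 2
    · linear_combination (h₁ - h₃) / 2
  ext i (j | j)
  · exact (key i j).1
  · exact (key i j).2

/-- Block-diagonal matrices whose upper block is the conjugate of the lower one. -/
def conjBlock (P : Matrix κ ι ℂ) : Matrix (Quad κ) (Quad ι) ℂ :=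
  Matrix.fromBlocks (P.map star) 0 0 P

theorem isConjMat_conjBlock (P : Matrix κ ι ℂ) : IsConjMat (conjBlock P) := by
  rintro (i | i) (j | j) <;> simp [conjBlock]

theorem conjBlock_conjTranspose (P : Matrix κ ι ℂ) : (conjBlock P)ᴴ = conjBlock Pᴴ := by
  ext (i | i) (j | j) <;> simp [conjBlock]

theorem conjBlock_mul [Fintype ι] {ι' : Type} (P : Matrix κ ι ℂ) (Q : Matrix ι ι' ℂ) :
    conjBlock P * conjBlock Q = conjBlock (P * Q) := by
  have h : (P * Q).map star = P.map star * Q.map star := by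
    ext i j; simp [Matrix.mul_apply]
  rw [conjBlock, conjBlock, conjBlock, Matrix.fromBlocks_multiply, h]
  simp

theorem conjBlock_add (P Q : Matrix κ ι ℂ) :
    conjBlock P + conjBlock Q = conjBlock (P + Q) := by
  ext (i | i) (j | j) <;> simp [conjBlock]

@[simp] theorem toBlocks₂₂_conjBlock (P : Matrix κ ι ℂ) : (conjBlock P).toBlocks₂₂ = P := rfl

theorem toBlocks₂₂_conjBlock_mul_mul [Fintype ι] (P : Matrix κ ι ℂ)
    (M : Matrix (Quad ι) (Quad ι) ℂ) :
    (conjBlock P * M * (conjBlock P)ᴴ).toBlocks₂₂ = P * M.toBlocks₂₂ * Pᴴ := by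
  rw [conjBlock_conjTranspose, conjBlock, ← Matrix.fromBlocks_toBlocks M, conjBlock,
    Matrix.fromBlocks_multiply, Matrix.fromBlocks_multiply]
  simp

theorem IsConjMat.eq_conjBlock {M : Matrix (Quad κ) (Quad ι) ℂ} (hM : IsConjMat M)
    (h : ∀ i j, M (Sum.inr i) (Sum.inl j) = 0) : M = conjBlock M.toBlocks₂₂ := by
  ext (i | i) (j | j)
  · simpa [conjBlock, Matrix.toBlocks₂₂] using (hM (Sum.inr i) (Sum.inr j)).symm
  · simpa [conjBlock, h] using (hM (Sum.inr i) (Sum.inl j)).symm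
  · simp [conjBlock, h]
  · rfl

variable [Fintype ι] [DecidableEq ι] [Fintype κ] [DecidableEq κ]

omit [DecidableEq ι] [DecidableEq κ] in
theorem posSemidef_fromBlocks_zero {P : Matrix ι ι ℂ} {Q : Matrix κ κ ℂ} (hP : P.PosSemidef)
    (hQ : Q.PosSemidef) : (Matrix.fromBlocks P 0 0 Q).PosSemidef := by
  refine Matrix.PosSemidef.of_dotProduct_mulVec_nonneg
    (Matrix.IsHermitian.fromBlocks hP.1 (by simp) hQ.1) fun x => ?_
  have h1 := hP.dotProduct_mulVec_nonneg (x ∘ Sum.inl)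
  have h2 := hQ.dotProduct_mulVec_nonneg (x ∘ Sum.inr)
  have h3 : star x = Sum.elim (star (x ∘ Sum.inl)) (star (x ∘ Sum.inr)) := by
    ext (i | i) <;> rfl
  rw [Matrix.fromBlocks_mulVec, h3, sumElim_dotProduct_sumElim]
  simpa using add_nonneg h1 h2

omit [Fintype ι] [DecidableEq ι] in
theorem posSemidef_map_star {P : Matrix ι ι ℂ} (hP : P.PosSemidef) :
    (P.map star).PosSemidef := by
  have h : P.map star = Pᵀ := by
    conv_rhs => rw [← hP.1.eq]
    rfl
  exact h ▸ hP.transpose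

omit [Fintype ι] in
theorem Z_eq_fromBlocks :
    Z ι = Matrix.fromBlocks ((1 / 2 : ℂ) • 1) 0 0 (-((1 / 2 : ℂ) • 1)) := by
  ext (i | i) (j | j) <;> by_cases h : i = j <;> simp [Z, h]

/-- The Gaussian state with first moments `r`, second moments `μ`, and `χ = 0`. The uncertainty
relation reduces to `μ ≥ 1/2`; the other block `μ* ≥ -1/2` is then automatic. -/
def diagState (r : Quad ι → ℂ) (hr : IsConjVec r) (μ : Matrix ι ι ℂ)
    (hμ : (μ - (1 / 2 : ℂ) • 1).PosSemidef) : GaussianState ι where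
  r := r
  M := conjBlock μ
  r_conj := hr
  M_conj := isConjMat_conjBlock μ
  uncertainty := by
    have h : conjBlock μ + Z ι = Matrix.fromBlocks
        ((μ - (1 / 2 : ℂ) • 1).map star + 1) 0 0 (μ - (1 / 2 : ℂ) • 1) := by
      rw [Z_eq_fromBlocks, conjBlock, Matrix.fromBlocks_add]
      congr 1
      · ext i j
        by_cases h : i = j
        · have h2 : (starRingEnd ℂ) 2 = 2 := map_ofNat _ 2
          simp [h, h2]; ring
        · simp [h]
      · simp
      · simp
    rw [h]
    exact posSemidef_fromBlocks_zero ((posSemidef_map_star hμ).add Matrix.PosSemidef.one) hμ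

/-- A coherent state: the vacuum displaced to the first moments `r`. -/
def coherent (r : Quad ι → ℂ) (hr : IsConjVec r) : GaussianState ι :=
  diagState r hr ((1 / 2 : ℂ) • 1) (by rw [sub_self]; exact Matrix.PosSemidef.zero)

/-! ### The structure of covariant channels -/

/-- Phases of distinct frequencies separate: at time `π / (a - b)` they are opposite. -/
theorem eq_zero_of_phases {a b : ℝ} (hab : a ≠ b) {z : ℂ}
    (h : ∀ t : ℝ, Complex.exp (Complex.I * (a * t : ℝ)) * z =
      Complex.exp (Complex.I * (b * t : ℝ)) * z) : z = 0 := by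
  have ht := h (Real.pi / (a - b))
  have hsub : a - b ≠ 0 := sub_ne_zero.2 hab
  have e : Complex.I * ((a * (Real.pi / (a - b)) : ℝ) : ℂ)
      = Complex.I * ((b * (Real.pi / (a - b)) : ℝ) : ℂ) + Real.pi * Complex.I := by
    have : a * (Real.pi / (a - b)) = b * (Real.pi / (a - b)) + Real.pi := by
      field_simp; ring
    rw [this]; push_cast; ring
  rw [e, Complex.exp_add, Complex.exp_pi_mul_I] at ht
  have h2 : Complex.exp (Complex.I * ((b * (Real.pi / (a - b)) : ℝ) : ℂ)) * z = 0 := by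
    linear_combination -ht / 2
  exact (mul_eq_zero.1 h2).resolve_left (Complex.exp_ne_zero _)

/-- The signed frequencies of the ladder operators: coordinate `i` of `Quad ι` evolves with the
phase `exp (i t · signedFreq ω i)`, so annihilation operators carry `-ω` and creation operators
carry `ω`. -/
def signedFreq (ω : ι → ℝ) : Quad ι → ℝ := Sum.elim (-ω) ω

namespace GaussianChannel

theorem timeTranslation_X (ω : ι → ℝ) (t : ℝ) : (timeTranslation ω t).X =
    Matrix.diagonal fun i => Complex.exp (Complex.I * (signedFreq ω i * t : ℝ)) := by
  simp only [timeTranslation]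
  congr 1
  ext (i | i) <;> simp [signedFreq]

theorem apply_r (E : GaussianChannel ι κ) (ρ : GaussianState ι) :
    (E.apply ρ).r = E.X *ᵥ ρ.r + E.d := rfl

theorem apply_M (E : GaussianChannel ι κ) (ρ : GaussianState ι) :
    (E.apply ρ).M = E.X * ρ.M * E.Xᴴ + E.Y := rfl

theorem timeTranslation_apply_r (ω : ι → ℝ) (t : ℝ) (ρ : GaussianState ι) :
    ((timeTranslation ω t).apply ρ).r = (timeTranslation ω t).X *ᵥ ρ.r :=
  add_zero _

theorem timeTranslation_apply_M (ω : ι → ℝ) (t : ℝ) (ρ : GaussianState ι) :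
    ((timeTranslation ω t).apply ρ).M =
      (timeTranslation ω t).X * ρ.M * (timeTranslation ω t).Xᴴ :=
  add_zero _

namespace IsCovariant

variable {E : GaussianChannel ι κ} {ω : ι → ℝ} {ν : κ → ℝ}

theorem d_fixed (h : E.IsCovariant ω ν) (t : ℝ) : (timeTranslation ν t).X *ᵥ E.d = E.d := by
  have h0 := congrArg GaussianState.r (h t (coherent 0 fun _ => by simp))
  rw [apply_r, timeTranslation_apply_r, timeTranslation_apply_r, apply_r] at h0
  simpa [coherent, diagState] using h0.symm

/-- The identity is tested on coherent states, whose first moments are arbitrary. -/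
theorem X_comm (h : E.IsCovariant ω ν) (t : ℝ) :
    E.X * (timeTranslation ω t).X = (timeTranslation ν t).X * E.X := by
  refine eq_of_mulVec_eq_of_isConjVec fun r hr => ?_
  have h1 := congrArg GaussianState.r (h t (coherent r hr))
  rw [apply_r, timeTranslation_apply_r, timeTranslation_apply_r, apply_r] at h1
  simpa [coherent, diagState, Matrix.mulVec_add, h.d_fixed t, Matrix.mulVec_mulVec] using h1

theorem Y_fixed (h : E.IsCovariant ω ν) (t : ℝ) :
    (timeTranslation ν t).X * E.Y * (timeTranslation ν t).Xᴴ = E.Y := by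
  have h0 := congrArg GaussianState.M (h t (coherent 0 fun _ => by simp))
  rw [apply_M, timeTranslation_apply_M, timeTranslation_apply_M, apply_M, Matrix.mul_add,
    Matrix.add_mul] at h0
  have h1 : ∀ M : Matrix (Quad ι) (Quad ι) ℂ,
      E.X * ((timeTranslation ω t).X * M * (timeTranslation ω t).Xᴴ) * E.Xᴴ =
      (timeTranslation ν t).X * (E.X * M * E.Xᴴ) * (timeTranslation ν t).Xᴴ := by
    intro M
    calc _ = (E.X * (timeTranslation ω t).X) * M * (E.X * (timeTranslation ω t).X)ᴴ := by
          simp only [Matrix.conjTranspose_mul, Matrix.mul_assoc]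
      _ = _ := by
          rw [h.X_comm t]
          simp only [Matrix.conjTranspose_mul, Matrix.mul_assoc]
  rw [h1] at h0
  exact (add_left_cancel h0).symm

theorem d_eq_zero (h : E.IsCovariant ω ν) (hν : ∀ k, 0 < ν k) : E.d = 0 := by
  funext i
  have hne : signedFreq ν i ≠ 0 := by
    rcases i with i | i
    · exact (neg_lt_zero.2 (hν i)).ne
    · exact (hν i).ne'
  refine eq_zero_of_phases hne fun t => ?_
  have := congrFun (h.d_fixed t) i
  rw [timeTranslation_X, Matrix.mulVec_diagonal] at this
  simpa using this

/-- The annihilation and creation operators rotate in opposite directions, so a positive input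
frequency cannot be matched with a negative output frequency. -/
theorem X_inr_inl (h : E.IsCovariant ω ν) (hω : ∀ j, 0 < ω j) (hν : ∀ k, 0 < ν k) (i : κ)
    (j : ι) : E.X (Sum.inr i) (Sum.inl j) = 0 := by
  have hne : ν i ≠ -ω j := by linarith [hω j, hν i]
  refine eq_zero_of_phases hne fun t => ?_
  have := congrFun (congrFun (h.X_comm t) (Sum.inr i)) (Sum.inl j)
  rw [timeTranslation_X, timeTranslation_X, Matrix.mul_diagonal, Matrix.diagonal_mul] at this
  rw [mul_comm _ (E.X _ _)]
  simpa [signedFreq, mul_comm] using this.symm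

/-- This entry of `Y` rotates with the frequency `ν i + ν j > 0` but has to be stationary. -/
theorem Y_inr_inl (h : E.IsCovariant ω ν) (hν : ∀ k, 0 < ν k) (i j : κ) :
    E.Y (Sum.inr i) (Sum.inl j) = 0 := by
  have hne : ν i + ν j ≠ 0 := (add_pos (hν i) (hν j)).ne'
  refine eq_zero_of_phases hne fun t => ?_
  have := congrFun (congrFun (h.Y_fixed t) (Sum.inr i)) (Sum.inl j)
  rw [timeTranslation_X, Matrix.diagonal_conjTranspose, Matrix.mul_diagonal,
    Matrix.diagonal_mul] at this
  simp only [signedFreq, Sum.elim_inr, Sum.elim_inl, Pi.star_apply, Complex.star_def,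
    ← Complex.exp_conj] at this
  rw [mul_right_comm, ← Complex.exp_add] at this
  simp only [zero_mul, Complex.ofReal_zero, mul_zero, Complex.exp_zero, one_mul]
  refine Eq.trans ?_ this
  congr 2
  simp
  ring

theorem X_eq (h : E.IsCovariant ω ν) (hω : ∀ j, 0 < ω j) (hν : ∀ k, 0 < ν k) :
    E.X = conjBlock E.A :=
  E.X_conj.eq_conjBlock (h.X_inr_inl hω hν)

theorem Y_eq (h : E.IsCovariant ω ν) (hν : ∀ k, 0 < ν k) : E.Y = conjBlock E.B :=
  E.Y_conj.eq_conjBlock (h.Y_inr_inl hν)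

/-- The lower right block of the complete positivity condition. -/
theorem posSemidef_noise (h : E.IsCovariant ω ν) (hω : ∀ j, 0 < ω j) (hν : ∀ k, 0 < ν k) :
    (E.B - (1 / 2 : ℂ) • (1 - E.A * E.Aᴴ)).PosSemidef := by
  have hs := E.cp.submatrix (Sum.inr : κ → Quad κ)
  have e : (E.Y - (E.X * Z ι * E.Xᴴ - Z κ)).submatrix Sum.inr Sum.inr =
      E.B - (1 / 2 : ℂ) • (1 - E.A * E.Aᴴ) := by
    rw [h.X_eq hω hν, h.Y_eq hν, conjBlock_conjTranspose, Z_eq_fromBlocks, Z_eq_fromBlocks]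
    simp only [conjBlock, Matrix.fromBlocks_multiply]
    ext i j
    simp
    ring
  rwa [e] at hs

end IsCovariant

/-! ### Free dilations -/

/-- The structure of a free dilation: with `W` the system-ancilla block of the unitary matrix
acting on the modes and `C` the second moments `μ_R` of the ancilla. -/
theorem FreelyDilatable.exists_block {E : GaussianChannel ι ι} {ω : ι → ℝ}
    (hE : E.FreelyDilatable ω) (hω : ∀ j, 0 < ω j) :
    ∃ (n : ℕ) (W : Matrix ι (Fin n) ℂ) (C : Matrix (Fin n) (Fin n) ℂ),
      E.A * E.Aᴴ + W * Wᴴ = 1 ∧ E.B = W * C * Wᴴ := by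
  obtain ⟨n, ν, ρR, U, hν, -, hU, hcov, hdil⟩ := hE
  have hων : ∀ k, 0 < Sum.elim ω ν k := by
    rintro (k | k)
    exacts [hω k, hν k]
  have hUX := hcov.X_eq hων hων
  set V := U.A with hV
  have hVV : V * Vᴴ = 1 := by
    have h := congrArg Matrix.toBlocks₂₂ hU.2
    rw [hUX, conjBlock_conjTranspose, Z_eq_fromBlocks] at h
    simp only [conjBlock, Matrix.fromBlocks_multiply, Matrix.toBlocks_fromBlocks₂₂] at h
    simpa using h
  have hVb := (Matrix.fromBlocks_toBlocks V).symm
  have hEX : E.X = U.X.submatrix (Sum.map Sum.inl Sum.inl) (Sum.map Sum.inl Sum.inl) := by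
    refine eq_of_mulVec_eq_of_isConjVec fun r hr => ?_
    -- Subtracting the equation for the vacuum removes the displacements and the first moments
    -- of the ancilla.
    have h0 := congrArg GaussianState.r (hdil (coherent 0 fun _ => by simp))
    have h1 := congrArg GaussianState.r (hdil (coherent r hr))
    funext i
    have h0 := congrFun h0 i
    have h1 := congrFun h1 i
    simp [apply_r, coherent, diagState, GaussianState.tensor, GaussianState.partialTrace,
      Matrix.mulVec, dotProduct, Fintype.sum_sum_type] at h0 h1 ⊢
    linear_combination h1 - h0
  have hA : E.A = V.toBlocks₁₁ := by
    ext i j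
    exact congrFun (congrFun hEX (Sum.inr i)) (Sum.inr j)
  -- The second moments of the output for the vacuum input `μ = 1/2` determine `B`.
  have hM := congrArg GaussianState.M (hdil (coherent 0 fun _ => by simp))
  have hB : E.A * ((1 / 2 : ℂ) • 1) * E.Aᴴ + E.B =
      (V * Matrix.fromBlocks ((1 / 2 : ℂ) • 1) 0 0 ρR.mu * Vᴴ).toBlocks₁₁ := by
    have hEX' : E.X = conjBlock E.A := by
      rw [hA, hEX, hUX]
      ext (i | i) (j | j) <;> rfl
    rw [apply_M, hEX'] at hM
    have h := congrArg Matrix.toBlocks₂₂ hM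
    change (conjBlock E.A * conjBlock ((1 / 2 : ℂ) • 1) * (conjBlock E.A)ᴴ).toBlocks₂₂ + E.B =
      ((U.X * _ * U.Xᴴ + U.Y).toBlocks₂₂).toBlocks₁₁ at h
    rw [hU.1, add_zero, hUX, toBlocks₂₂_conjBlock_mul_mul, toBlocks₂₂_conjBlock_mul_mul,
      toBlocks₂₂_conjBlock] at h
    rw [h]
    congr 3
    ext (i | i) (j | j) <;> rfl
  have hVVb := hVV
  rw [hVb, Matrix.fromBlocks_conjTranspose, Matrix.fromBlocks_multiply,
    ← Matrix.fromBlocks_one, Matrix.fromBlocks_inj] at hVVb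
  refine ⟨n, V.toBlocks₁₂, ρR.mu, ?_, ?_⟩
  · rw [hA]; exact hVVb.1
  · rw [hVb, Matrix.fromBlocks_conjTranspose, Matrix.fromBlocks_multiply,
      Matrix.fromBlocks_multiply, Matrix.toBlocks_fromBlocks₁₁, ← hA] at hB
    simpa using hB

theorem FreelyDilatable.posSemidef_one_sub {E : GaussianChannel ι ι} {ω : ι → ℝ}
    (hE : E.FreelyDilatable ω) (hω : ∀ j, 0 < ω j) : (1 - E.A * E.Aᴴ).PosSemidef := by
  obtain ⟨n, W, C, h, -⟩ := hE.exists_block hω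
  rw [← h, add_sub_cancel_left]
  exact Matrix.posSemidef_self_mul_conjTranspose W

end GaussianChannel

/-! ### Convergence of the series -/

omit [DecidableEq κ] in
theorem sum_pow_mul_mul_pow {W : Matrix ι κ ℂ} {A : Matrix ι ι ℂ} (h : A * Aᴴ + W * Wᴴ = 1)
    (N : ℕ) : ∑ n ∈ Finset.range N, (A ^ n * W) * (A ^ n * W)ᴴ = 1 - A ^ N * (A ^ N)ᴴ := by
  induction N with
  | zero => simp
  | succ N ih =>
    have hW : W * Wᴴ = 1 - A * Aᴴ := eq_sub_of_add_eq' h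
    have e : (A ^ N * W) * (A ^ N * W)ᴴ = A ^ N * (W * Wᴴ) * (A ^ N)ᴴ := by
      simp only [Matrix.conjTranspose_mul, Matrix.mul_assoc]
    rw [Finset.sum_range_succ, ih, e, hW, pow_succ, Matrix.conjTranspose_mul]
    simp only [Matrix.mul_sub, Matrix.sub_mul, Matrix.mul_one, Matrix.mul_assoc]
    abel

omit [Fintype ι] [DecidableEq ι] [DecidableEq κ] in
theorem mul_conjTranspose_apply_self (P : Matrix ι κ ℂ) (i : ι) :
    (P * Pᴴ) i i = ((∑ k, ‖P i k‖ ^ 2 : ℝ) : ℂ) := by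
  simp [Matrix.mul_apply, Complex.mul_conj, Complex.normSq_eq_norm_sq]

omit [DecidableEq κ] in
theorem summable_norm_sq_pow_mul {W : Matrix ι κ ℂ} {A : Matrix ι ι ℂ}
    (h : A * Aᴴ + W * Wᴴ = 1) (i : ι) (k : κ) :
    Summable fun n : ℕ => ‖(A ^ n * W) i k‖ ^ 2 := by
  refine summable_of_sum_range_le (c := 1) (fun _ => by positivity) fun N => ?_
  have e := congrFun (congrFun (sum_pow_mul_mul_pow h N) i) i
  rw [Matrix.sum_apply, Matrix.sub_apply, Matrix.one_apply_eq, mul_conjTranspose_apply_self] at e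
  simp only [mul_conjTranspose_apply_self] at e
  have e' : ∑ n ∈ Finset.range N, ∑ k, ‖(A ^ n * W) i k‖ ^ 2 =
      1 - ∑ k, ‖(A ^ N) i k‖ ^ 2 := by exact_mod_cast e
  calc ∑ n ∈ Finset.range N, ‖(A ^ n * W) i k‖ ^ 2
      ≤ ∑ n ∈ Finset.range N, ∑ k, ‖(A ^ n * W) i k‖ ^ 2 :=
        Finset.sum_le_sum fun n _ => Finset.single_le_sum
          (f := fun k => ‖(A ^ n * W) i k‖ ^ 2) (fun _ _ => by positivity) (Finset.mem_univ k)
    _ ≤ 1 := by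
        rw [e']
        linarith [Finset.sum_nonneg fun k (_ : k ∈ Finset.univ) => sq_nonneg ‖(A ^ N) i k‖]

omit [DecidableEq κ] in
/-- Entrywise, the series is a combination of products of two square-summable sequences. -/
theorem summable_pow_mul_mul_pow {W : Matrix ι κ ℂ} {A : Matrix ι ι ℂ}
    (h : A * Aᴴ + W * Wᴴ = 1) (C : Matrix κ κ ℂ) :
    Summable fun n : ℕ => A ^ n * (W * C * Wᴴ) * Aᴴ ^ n := by
  refine Pi.summable.2 fun i => Pi.summable.2 fun j => ?_
  have e : ∀ n : ℕ, (A ^ n * (W * C * Wᴴ) * Aᴴ ^ n) i j =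
      ∑ l, ∑ k, C k l * ((A ^ n * W) i k * star ((A ^ n * W) j l)) := by
    intro n
    have : A ^ n * (W * C * Wᴴ) * Aᴴ ^ n = (A ^ n * W) * C * (A ^ n * W)ᴴ := by
      simp only [Matrix.conjTranspose_mul, Matrix.conjTranspose_pow, Matrix.mul_assoc]
    rw [this, Matrix.mul_apply]
    refine Finset.sum_congr rfl fun l _ => ?_
    rw [Matrix.mul_apply, Finset.sum_mul]
    refine Finset.sum_congr rfl fun k _ => ?_
    rw [Matrix.conjTranspose_apply]
    ring
  simp only [e]
  refine summable_sum fun l _ => summable_sum fun k _ => Summable.mul_left _ ?_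
  refine Summable.of_norm_bounded
    ((summable_norm_sq_pow_mul h i k).add (summable_norm_sq_pow_mul h j l)) fun n => ?_
  rw [norm_mul, norm_star]
  nlinarith [sq_nonneg (‖(A ^ n * W) i k‖ - ‖(A ^ n * W) j l‖),
    sq_nonneg ‖(A ^ n * W) i k‖, sq_nonneg ‖(A ^ n * W) j l‖]

omit [DecidableEq ι] in
theorem posSemidef_of_hasSum {f : ℕ → Matrix ι ι ℂ} {S : Matrix ι ι ℂ} (hf : HasSum f S)
    (h : ∀ n, (f n).PosSemidef) : S.PosSemidef := by
  have hH : S.IsHermitian := by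
    have h1 := hf.matrix_conjTranspose
    simp only [(h _).1.eq] at h1
    exact h1.unique hf
  refine Matrix.PosSemidef.of_dotProduct_mulVec_nonneg hH fun x => ?_
  have hs : HasSum (fun n => star x ⬝ᵥ (f n *ᵥ x)) (star x ⬝ᵥ (S *ᵥ x)) := by
    let φ : Matrix ι ι ℂ →+ ℂ :=
      { toFun := fun M => star x ⬝ᵥ (M *ᵥ x)
        map_zero' := by simp
        map_add' := fun M N => by rw [Matrix.add_mulVec, dotProduct_add] }
    have hφ : Continuous φ :=
      continuous_const.dotProduct (continuous_id.matrix_mulVec continuous_const)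
    exact hf.map φ hφ
  exact hs.nonneg fun n => (h n).dotProduct_mulVec_nonneg x

/-- Conjugating by `A` shifts the index of the series by one. -/
theorem hasSum_fixed_point {A D S : Matrix ι ι ℂ}
    (hS : HasSum (fun n : ℕ => A ^ n * D * Aᴴ ^ n) S) : A * S * Aᴴ + D = S := by
  have h1 : HasSum (fun n : ℕ => A ^ (n + 1) * D * Aᴴ ^ (n + 1)) (A * S * Aᴴ) := by
    have h := (hS.mul_left A).mul_right Aᴴ
    have e : (fun n : ℕ => A ^ (n + 1) * D * Aᴴ ^ (n + 1)) =
        fun n => A * (A ^ n * D * Aᴴ ^ n) * Aᴴ := by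
      funext n
      rw [pow_succ', pow_succ]
      simp only [Matrix.mul_assoc]
    rw [e]
    exact h
  have h2 := (hasSum_nat_add_iff' 1).2 hS
  have h3 := h1.unique h2
  simp only [Finset.range_one, Finset.sum_singleton, pow_zero, Matrix.one_mul,
    Matrix.mul_one] at h3
  rw [h3, sub_add_cancel]

/-! ### The fixed state of a freely dilatable operation -/

theorem apply_diagState_zero_eq {E : GaussianChannel ι ι} (hd : E.d = 0) (hX : E.X = conjBlock E.A)
    (hY : E.Y = conjBlock E.B) {μ : Matrix ι ι ℂ} (hμ : (μ - (1 / 2 : ℂ) • 1).PosSemidef)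
    (hfix : E.A * μ * E.Aᴴ + E.B = μ) :
    E.apply (diagState 0 (fun _ => by simp) μ hμ) = diagState 0 (fun _ => by simp) μ hμ := by
  apply GaussianState.ext
  · simp [GaussianChannel.apply_r, diagState, hd]
  · rw [GaussianChannel.apply_M, hX, hY]
    simp only [diagState]
    rw [conjBlock_conjTranspose, conjBlock_mul, conjBlock_mul, conjBlock_add, hfix]

theorem exists_fixed_of_freelyDilatable {ω : ι → ℝ} (hω : ∀ j, 0 < ω j)
    {E : GaussianChannel ι ι} (hcov : E.IsCovariant ω ω) (hE : E.FreelyDilatable ω) :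
    ∃ ρ : GaussianState ι, E.apply ρ = ρ ∧ ρ.r = 0 ∧ ρ.chi = 0 ∧
      HasSum (fun n : ℕ => E.A ^ n * (E.B - (1 / 2 : ℂ) • (1 - E.A * E.Aᴴ)) * E.Aᴴ ^ n)
        (ρ.mu - (1 / 2 : ℂ) • 1) := by
  obtain ⟨n, W, C, hA, hB⟩ := hE.exists_block hω
  set D := E.B - (1 / 2 : ℂ) • (1 - E.A * E.Aᴴ) with hD
  have hDpos : D.PosSemidef := hcov.posSemidef_noise hω hω
  have hDW : D = W * (C - (1 / 2 : ℂ) • 1) * Wᴴ := by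
    rw [hD, ← hA, hB, add_sub_cancel_left]
    simp [Matrix.mul_sub, Matrix.sub_mul]
  obtain ⟨S, hS⟩ := hDW ▸ summable_pow_mul_mul_pow hA (C - (1 / 2 : ℂ) • 1)
  have hSpos : S.PosSemidef := posSemidef_of_hasSum hS fun n => by
    rw [← Matrix.conjTranspose_pow]
    exact hDpos.mul_mul_conjTranspose_same _
  have hSfix := hasSum_fixed_point hS
  have hμ : (S + (1 / 2 : ℂ) • 1 - (1 / 2 : ℂ) • 1).PosSemidef := by
    rwa [add_sub_cancel_right]
  refine ⟨diagState 0 (fun _ => by simp) _ hμ,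
    apply_diagState_zero_eq (hcov.d_eq_zero hω) (hcov.X_eq hω hω) (hcov.Y_eq hω) hμ ?_,
    rfl, rfl, ?_⟩
  · conv_rhs => rw [← hSfix]
    rw [hD]
    simp only [Matrix.mul_add, Matrix.add_mul, smul_sub, Matrix.mul_smul, Matrix.smul_mul,
      Matrix.mul_one]
    abel
  · have : (diagState 0 (fun _ => by simp) _ hμ : GaussianState ι).mu = S + (1 / 2 : ℂ) • 1 := rfl
    rw [this, add_sub_cancel_right]
    exact hS

/-! ### Two-mode counterexamples to the converse -/

/-- The channel with block-diagonal `X` and `Y`, without displacement. The two hypotheses are the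
two diagonal blocks of the complete positivity condition. -/
def blockChannel (A B : Matrix ι ι ℂ) (h₁ : (B - (1 / 2 : ℂ) • (A * Aᴴ - 1)).PosSemidef)
    (h₂ : (B - (1 / 2 : ℂ) • (1 - A * Aᴴ)).PosSemidef) : GaussianChannel ι ι where
  X := conjBlock A
  Y := conjBlock B
  d := 0
  X_conj := isConjMat_conjBlock A
  Y_conj := isConjMat_conjBlock B
  d_conj := fun _ => by simp
  cp := by
    have h : conjBlock B - (conjBlock A * Z ι * (conjBlock A)ᴴ - Z ι) = Matrix.fromBlocks
        ((B - (1 / 2 : ℂ) • (A * Aᴴ - 1)).map star) 0 0 (B - (1 / 2 : ℂ) • (1 - A * Aᴴ)) := by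
      rw [conjBlock_conjTranspose, Z_eq_fromBlocks]
      simp only [conjBlock, Matrix.fromBlocks_multiply]
      ext (i | i) (j | j)
      · have h2 : (starRingEnd ℂ) 2 = 2 := map_ofNat _ 2
        by_cases h : i = j <;> simp [h, h2, Matrix.mul_apply, mul_comm]
        ring
      · simp
      · simp
      · simp
        ring
    rw [h]
    exact posSemidef_fromBlocks_zero (posSemidef_map_star h₁) h₂

/-- For equal frequencies the time translation is scalar on each block. -/
theorem isCovariant_blockChannel (A B : Matrix ι ι ℂ)
    (h₁ : (B - (1 / 2 : ℂ) • (A * Aᴴ - 1)).PosSemidef)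
    (h₂ : (B - (1 / 2 : ℂ) • (1 - A * Aᴴ)).PosSemidef) (ω : ℝ) :
    (blockChannel A B h₁ h₂).IsCovariant (fun _ => ω) (fun _ => ω) := by
  intro t ρ
  set T := (GaussianChannel.timeTranslation (fun _ : ι => ω) t).X with hT
  have hX : conjBlock A * T = T * conjBlock A := by
    rw [hT, GaussianChannel.timeTranslation_X]
    ext (i | i) (j | j) <;>
      simp [Matrix.mul_diagonal, Matrix.diagonal_mul, conjBlock, signedFreq, mul_comm]
  have hY : T * conjBlock B * Tᴴ = conjBlock B := by
    rw [hT, GaussianChannel.timeTranslation_X, Matrix.diagonal_conjTranspose]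
    ext (i | i) (j | j) <;>
      simp [Matrix.mul_diagonal, Matrix.diagonal_mul, conjBlock, signedFreq, ← Complex.exp_conj]
    all_goals
      rw [mul_right_comm, ← Complex.exp_add]
      simp
  apply GaussianState.ext
  · rw [GaussianChannel.apply_r, GaussianChannel.timeTranslation_apply_r,
      GaussianChannel.timeTranslation_apply_r, GaussianChannel.apply_r, ← hT]
    simp [blockChannel, hX]
  · rw [GaussianChannel.apply_M, GaussianChannel.timeTranslation_apply_M,
      GaussianChannel.timeTranslation_apply_M, GaussianChannel.apply_M, ← hT]
    change conjBlock A * (T * ρ.M * Tᴴ) * (conjBlock A)ᴴ + conjBlock B =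
      T * (conjBlock A * ρ.M * (conjBlock A)ᴴ + conjBlock B) * Tᴴ
    rw [Matrix.mul_add, Matrix.add_mul, hY]
    congr 1
    calc _ = (conjBlock A * T) * ρ.M * (conjBlock A * T)ᴴ := by
          simp only [Matrix.conjTranspose_mul, Matrix.mul_assoc]
      _ = _ := by
          rw [hX]
          simp only [Matrix.conjTranspose_mul, Matrix.mul_assoc]

theorem posSemidef_real_diag {a b : ℝ} (ha : 0 ≤ a) (hb : 0 ≤ b) :
    (!![(a : ℂ), 0; 0, (b : ℂ)]).PosSemidef := by
  have : !![(a : ℂ), 0; 0, (b : ℂ)] = Matrix.diagonal ![(a : ℂ), (b : ℂ)] := by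
    ext i j; fin_cases i <;> fin_cases j <;> simp
  rw [this]
  refine Matrix.PosSemidef.diagonal fun i => ?_
  fin_cases i
  · simpa using ha
  · simpa using hb

theorem swap_mul_diag_mul {x y : ℝ} (hx : 0 ≤ x) (hy : 0 ≤ y) (a b : ℝ) :
    !![0, (Real.sqrt x : ℂ); (Real.sqrt y : ℂ), 0] * !![(a : ℂ), 0; 0, (b : ℂ)] *
      !![0, (Real.sqrt x : ℂ); (Real.sqrt y : ℂ), 0]ᴴ =
      !![((x * b : ℝ) : ℂ), 0; 0, ((y * a : ℝ) : ℂ)] := by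
  have ex : (Real.sqrt x : ℂ) * (Real.sqrt x : ℂ) = x := by
    exact_mod_cast Real.mul_self_sqrt hx
  have ey : (Real.sqrt y : ℂ) * (Real.sqrt y : ℂ) = y := by
    exact_mod_cast Real.mul_self_sqrt hy
  ext i j
  fin_cases i <;> fin_cases j <;> simp [Matrix.mul_apply, Fin.sum_univ_two]
  · rw [mul_right_comm, ex]
  · rw [mul_right_comm, ey]

theorem exists_not_freelyDilatable_two_mode (ω η₁ η₂ b₁ b₂ : ℝ) (hω : 0 < ω) (h₁ : 0 ≤ η₁)
    (h₂ : 1 < η₂) (h₁₂ : η₁ * η₂ < 1) (hb₁ : (1 - η₁) / 2 ≤ b₁) (hb₂ : (η₂ - 1) / 2 ≤ b₂) :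
    ∃ E : GaussianChannel (Fin 2) (Fin 2),
      E.IsCovariant (fun _ => ω) (fun _ => ω) ∧
      E.A = !![0, (Real.sqrt η₁ : ℂ); (Real.sqrt η₂ : ℂ), 0] ∧
      E.B = !![(b₁ : ℂ), 0; 0, (b₂ : ℂ)] ∧
      (∃ ρ : GaussianState (Fin 2), E.apply ρ = ρ ∧ ρ.r = 0 ∧ ρ.chi = 0 ∧
        ρ.mu = !![(((b₁ + η₁ * b₂) / (1 - η₁ * η₂) : ℝ) : ℂ), 0;
          0, (((b₂ + η₂ * b₁) / (1 - η₁ * η₂) : ℝ) : ℂ)]) ∧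
      ¬ (1 - E.A * E.Aᴴ).PosSemidef ∧
      ¬ E.FreelyDilatable (fun _ => ω) := by
  set A : Matrix (Fin 2) (Fin 2) ℂ := !![0, (Real.sqrt η₁ : ℂ); (Real.sqrt η₂ : ℂ), 0] with hA
  set B : Matrix (Fin 2) (Fin 2) ℂ := !![(b₁ : ℂ), 0; 0, (b₂ : ℂ)] with hB
  have hη₂ : 0 ≤ η₂ := by linarith
  have hη₁ : η₁ ≤ 1 := by nlinarith
  have hone : (1 : Matrix (Fin 2) (Fin 2) ℂ) = !![((1 : ℝ) : ℂ), 0; 0, ((1 : ℝ) : ℂ)] := by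
    simp [Matrix.one_fin_two]
  have hAA : A * Aᴴ = !![(η₁ : ℂ), 0; 0, (η₂ : ℂ)] := by
    have h := swap_mul_diag_mul h₁ hη₂ 1 1
    rw [← hone, Matrix.mul_one, mul_one, mul_one] at h
    exact h
  have hcp₁ : (B - (1 / 2 : ℂ) • (A * Aᴴ - 1)).PosSemidef := by
    have e : B - (1 / 2 : ℂ) • (A * Aᴴ - 1) =
        !![((b₁ - (η₁ - 1) / 2 : ℝ) : ℂ), 0; 0, ((b₂ - (η₂ - 1) / 2 : ℝ) : ℂ)] := by
      rw [hAA, hone, hB]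
      ext i j; fin_cases i <;> fin_cases j <;> simp <;> ring
    rw [e]
    exact posSemidef_real_diag (by linarith) (by linarith)
  have hcp₂ : (B - (1 / 2 : ℂ) • (1 - A * Aᴴ)).PosSemidef := by
    have e : B - (1 / 2 : ℂ) • (1 - A * Aᴴ) =
        !![((b₁ - (1 - η₁) / 2 : ℝ) : ℂ), 0; 0, ((b₂ - (1 - η₂) / 2 : ℝ) : ℂ)] := by
      rw [hAA, hone, hB]
      ext i j; fin_cases i <;> fin_cases j <;> simp <;> ring
    rw [e]
    exact posSemidef_real_diag (by linarith) (by linarith)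
  have hden : 0 < 1 - η₁ * η₂ := by linarith
  set p := (b₁ + η₁ * b₂) / (1 - η₁ * η₂) with hp
  set q := (b₂ + η₂ * b₁) / (1 - η₁ * η₂) with hq
  have hμ : (!![(p : ℂ), 0; 0, (q : ℂ)] - (1 / 2 : ℂ) • 1).PosSemidef := by
    have e : !![(p : ℂ), 0; 0, (q : ℂ)] - (1 / 2 : ℂ) • 1 =
        !![((p - 1 / 2 : ℝ) : ℂ), 0; 0, ((q - 1 / 2 : ℝ) : ℂ)] := by
      rw [hone]
      ext i j; fin_cases i <;> fin_cases j <;> simp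
    rw [e]
    refine posSemidef_real_diag (sub_nonneg.2 ?_) (sub_nonneg.2 ?_)
    -- With the lower bounds on `b₁` and `b₂`, both inequalities reduce to `η₂ ≥ 1`.
    · rw [hp, le_div_iff₀ hden]
      nlinarith [mul_le_mul_of_nonneg_left hb₂ h₁]
    · rw [hq, le_div_iff₀ hden]
      nlinarith [mul_le_mul_of_nonneg_left hb₁ hη₂]
  have hnot : ¬ (1 - A * Aᴴ).PosSemidef := by
    intro h
    have h11 := h.diag_nonneg (i := 1)
    rw [hAA] at h11
    have : (0 : ℂ) ≤ ((1 - η₂ : ℝ) : ℂ) := by simpa using h11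
    have := Complex.zero_le_real.1 this
    linarith
  refine ⟨blockChannel A B hcp₁ hcp₂, isCovariant_blockChannel A B hcp₁ hcp₂ ω, rfl, rfl,
    ⟨diagState 0 (fun _ => by simp) _ hμ,
      apply_diagState_zero_eq rfl rfl rfl hμ ?_, rfl, rfl, rfl⟩, hnot,
    fun h => hnot (h.posSemidef_one_sub fun _ => hω)⟩
  change A * !![(p : ℂ), 0; 0, (q : ℂ)] * Aᴴ + B = _
  have hp' : p * (1 - η₁ * η₂) = b₁ + η₁ * b₂ := div_mul_cancel₀ _ hden.ne'
  have hq' : q * (1 - η₁ * η₂) = b₂ + η₂ * b₁ := div_mul_cancel₀ _ hden.ne'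
  have hpq : η₁ * q + b₁ = p := by
    apply mul_right_cancel₀ hden.ne'
    linear_combination η₁ * hq' - hp'
  have hqp : η₂ * p + b₂ = q := by
    apply mul_right_cancel₀ hden.ne'
    linear_combination η₂ * hp' - hq'
  rw [swap_mul_diag_mul h₁ hη₂, hB]
  have hpq_cast : (η₁ : ℂ) * q + b₁ = p := by exact_mod_cast hpq
  have hqp_cast : (η₂ : ℂ) * p + b₂ = q := by exact_mod_cast hqp
  ext i j; fin_cases i <;> fin_cases j <;> simp [hpq_cast, hqp_cast]

end GaussianCV

end

open GaussianCV in
theorem theorem1 :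
    -- A covariant operation without a fixed state is not freely dilatable.
    (∀ (m : ℕ) (ω : Fin m → ℝ), (∀ j, 0 < ω j) →
      ∀ E : GaussianChannel (Fin m) (Fin m), E.IsCovariant ω ω →
        (¬ ∃ ρ : GaussianState (Fin m), E.apply ρ = ρ) → ¬ E.FreelyDilatable ω) ∧
    -- The fixed state of a freely dilatable operation:
    -- `μ⋆ = I/2 + ∑ Aⁿ Δ (A†)ⁿ` with `Δ = B - (I - A A†)/2`.
    (∀ (m : ℕ) (ω : Fin m → ℝ), (∀ j, 0 < ω j) →
      ∀ E : GaussianChannel (Fin m) (Fin m), E.IsCovariant ω ω → E.FreelyDilatable ω →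
        ∃ ρ : GaussianState (Fin m), E.apply ρ = ρ ∧ ρ.r = 0 ∧ ρ.chi = 0 ∧
          HasSum (fun n : ℕ => E.A ^ n * (E.B - (1 / 2 : ℂ) • (1 - E.A * E.Aᴴ)) * E.Aᴴ ^ n)
            (ρ.mu - (1 / 2 : ℂ) • 1)) ∧
    -- The converse is false.
    (¬ ∀ (m : ℕ) (ω : Fin m → ℝ), (∀ j, 0 < ω j) →
      ∀ E : GaussianChannel (Fin m) (Fin m), E.IsCovariant ω ω →
        ¬ E.FreelyDilatable ω → ¬ ∃ ρ : GaussianState (Fin m), E.apply ρ = ρ) ∧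
    -- An explicit family of two-mode counterexamples to the converse, violating `I - A A† ≥ 0`.
    (∀ ω η₁ η₂ b₁ b₂ : ℝ, 0 < ω → 0 ≤ η₁ → 1 < η₂ → η₁ * η₂ < 1 →
      (1 - η₁) / 2 ≤ b₁ → (η₂ - 1) / 2 ≤ b₂ →
      ∃ E : GaussianChannel (Fin 2) (Fin 2),
        E.IsCovariant (fun _ => ω) (fun _ => ω) ∧
        E.A = !![0, (Real.sqrt η₁ : ℂ); (Real.sqrt η₂ : ℂ), 0] ∧
        E.B = !![(b₁ : ℂ), 0; 0, (b₂ : ℂ)] ∧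
        (∃ ρ : GaussianState (Fin 2), E.apply ρ = ρ ∧ ρ.r = 0 ∧ ρ.chi = 0 ∧
          ρ.mu = !![(((b₁ + η₁ * b₂) / (1 - η₁ * η₂) : ℝ) : ℂ), 0;
            0, (((b₂ + η₂ * b₁) / (1 - η₁ * η₂) : ℝ) : ℂ)]) ∧
        ¬ (1 - E.A * E.Aᴴ).PosSemidef ∧
        ¬ E.FreelyDilatable (fun _ => ω)) := by
  refine ⟨fun m ω hω E hcov hno hE => ?_, fun m ω hω E hcov hE =>
    exists_fixed_of_freelyDilatable hω hcov hE, fun hconv => ?_, fun ω η₁ η₂ b₁ b₂ =>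
    exists_not_freelyDilatable_two_mode ω η₁ η₂ b₁ b₂⟩
  · obtain ⟨ρ, hρ, -⟩ := exists_fixed_of_freelyDilatable hω hcov hE
    exact hno ⟨ρ, hρ⟩
  · obtain ⟨E, hcov, -, -, ⟨ρ, hρ, -⟩, -, hE⟩ :=
      exists_not_freelyDilatable_two_mode 1 0 2 (1 / 2) (1 / 2) one_pos le_rfl (by norm_num)
        (by norm_num) (by norm_num) (by norm_num)
    exact hconv 2 (fun _ => 1) (fun _ => one_pos) E hcov hE ⟨ρ, hρ⟩
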